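/- Let $N\ge 1$ be an integer and let $V_N$ be a random matrix distributed according to the Haar probability measure on the unitary group $U(N)$. Let $\theta\in\mathbb{R}$ and let $Z_N=\det(I_N-e^{-\mathrm{i}\theta}V_N)$ be the characteristic polynomial of $V_N$ evaluated at $\theta$. Then $Z_N\neq 0$ almost surely, and the law of the real random variable $\log|Z_N|$ is infinitely divisible: for every integer $n\ge 1$ there is a probability measure $\nu_n$ on $\mathbb{R}$ such that $\log|Z_N|$ has the same law as $X_1+\dots+X_n$, where $X_1,\dots,X_n$ are independent random variables, each with law $\nu_n$. -/

import Mathlib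

open MeasureTheory

/-- The unitary group `U(N)` is compact. -/
instance unitaryGroup_compactSpace (N : ℕ) :
    CompactSpace (Matrix.unitaryGroup (Fin N) ℂ) := by
  apply isCompact_iff_compactSpace.mp
  have hc : IsClosed {A : Matrix (Fin N) (Fin N) ℂ | A ∈ Matrix.unitaryGroup (Fin N) ℂ} := by
    simp only [Matrix.mem_unitaryGroup_iff]
    exact isClosed_eq (by fun_prop) continuous_const
  have hK : IsCompact {A : Matrix (Fin N) (Fin N) ℂ |
      ∀ i, A i ∈ {v : Fin N → ℂ | ∀ j, v j ∈ Metric.closedBall (0 : ℂ) 1}} :=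
    isCompact_pi_infinite fun _ => isCompact_pi_infinite fun _ => isCompact_closedBall 0 1
  refine hK.of_isClosed_subset hc ?_
  intro A hA i j
  simpa using entry_norm_bound_of_unitary hA i j

/-- `U(N)` carries its Borel `σ`-algebra. -/
noncomputable instance unitaryGroup_measurableSpace (N : ℕ) :
    MeasurableSpace (Matrix.unitaryGroup (Fin N) ℂ) := borel _

instance unitaryGroup_borelSpace (N : ℕ) :
    BorelSpace (Matrix.unitaryGroup (Fin N) ℂ) := ⟨rfl⟩

/-- The Haar measure of the compact group `U(N)`, normalised to have total mass `1`. -/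
noncomputable def haarUnitary (N : ℕ) : Measure (Matrix.unitaryGroup (Fin N) ℂ) :=
  Measure.haarMeasure ⊤

instance haarUnitary_isProbabilityMeasure (N : ℕ) : IsProbabilityMeasure (haarUnitary N) :=
  ⟨by simpa [haarUnitary] using
    Measure.haarMeasure_self (K₀ := (⊤ : TopologicalSpace.PositiveCompacts
      (Matrix.unitaryGroup (Fin N) ℂ)))⟩

instance haarUnitary_isHaarMeasure (N : ℕ) : (haarUnitary N).IsHaarMeasure :=
  Measure.isHaarMeasure_haarMeasure _

/-- The characteristic polynomial `Z(V, θ) = det(I - e^{-iθ} V)` of a unitary matrix `V`. -/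
noncomputable def charPolyZ {N : ℕ} (V : Matrix.unitaryGroup (Fin N) ℂ) (θ : ℝ) : ℂ :=
  (1 - Complex.exp (-(Complex.I * θ)) • (V : Matrix (Fin N) (Fin N) ℂ)).det

/-- A Borel measure `μ` on `ℝ` is infinitely divisible if for every `n ≥ 1` there is a probability
measure `ν` on `ℝ` such that `μ` is the law of the sum of `n` independent random variables, each
of law `ν`. -/
def IsInfinitelyDivisible (μ : Measure ℝ) : Prop :=
  ∀ n : ℕ, 1 ≤ n → ∃ ν : Measure ℝ, IsProbabilityMeasure ν ∧
    μ = (Measure.pi fun _ : Fin n => ν).map (fun x => ∑ i, x i)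

open Filter Topology Finset
open scoped ComplexConjugate

/-! Rescaled into `[0, 1]`, `|Z_N|²` has a law determined by its moments. So it suffices that, for
every `n`, the `n`-th roots of these moments are the moments of some law `ρ` on `[0, 1]`: a product
of `n` independent variables of law `ρ` then has the right law, and logarithms turn it into a sum.

Haar invariance reduces to `θ = 0`. Replacing `V` by `V (1 ⊕ U)`, with `U` Haar on the smaller
group, splits off the factor `1 - V 0 0` (`integral_norm_det_pow_succ`). The moments of the corner
entry then give `E |Z_N|^(2p) = ∏_{j=1}^N (j)_{2p} / (j)_p²` in rising factorials
(`integral_norm_det_one_sub_pow`).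

By the duplication formula each factor is `4^p` times two Beta moments. A Beta moment is an infinite
product of ratios `c (d + p) / (d (c + p))` with `c ≤ d`. The logarithm of such a ratio is a
nonnegative series of terms `m p - 1` with `m` a moment sequence, so its powers are limits of
products of `exp (l (m p - 1))`: compound Poisson laws on the logarithmic scale (`ratio_rpow`,
`beta_rpow`). -/

/-- `m` is the sequence of moments of a probability measure on `[0, 1]`. -/
def IsHausdorffMomentSeq (m : ℕ → ℝ) : Prop :=
  ∃ μ : ProbabilityMeasure unitInterval, ∀ p, ∫ x, (x : ℝ) ^ p ∂(μ : Measure unitInterval) = m p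

/-! ### Moment sequences on `[0, 1]`: closure properties and building blocks. -/

namespace IsHausdorffMomentSeq

theorem one : IsHausdorffMomentSeq fun _ => 1 :=
  ⟨⟨Measure.dirac 1, inferInstance⟩, fun p => by simp⟩

/-- Moments multiply when independent variables are multiplied. -/
theorem mul {m m' : ℕ → ℝ} (h : IsHausdorffMomentSeq m) (h' : IsHausdorffMomentSeq m') :
    IsHausdorffMomentSeq fun p => m p * m' p := by
  obtain ⟨μ, hμ⟩ := h
  obtain ⟨ν, hν⟩ := h'
  have hm : Measurable fun z : unitInterval × unitInterval => z.1 * z.2 :=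
    (continuous_fst.mul continuous_snd).measurable
  refine ⟨⟨((μ : Measure unitInterval).prod ν).map fun z => z.1 * z.2,
    Measure.isProbabilityMeasure_map hm.aemeasurable⟩, fun p => ?_⟩
  simp only [ProbabilityMeasure.coe_mk]
  rw [integral_map hm.aemeasurable (by fun_prop)]
  simp only [Set.Icc.coe_mul, mul_pow]
  rw [integral_prod_mul (fun x : unitInterval => (x : ℝ) ^ p) fun x : unitInterval => (x : ℝ) ^ p,
    hμ, hν]

theorem prod {ι : Type*} (s : Finset ι) {m : ι → ℕ → ℝ}
    (h : ∀ i ∈ s, IsHausdorffMomentSeq (m i)) :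
    IsHausdorffMomentSeq fun p => ∏ i ∈ s, m i p := by
  classical
  induction s using Finset.induction_on with
  | empty => simpa using one
  | insert a s ha ih =>
    simp only [Finset.prod_insert ha]
    exact (h a (by simp)).mul (ih fun i hi => h i (by simp [hi]))

theorem pow {m : ℕ → ℝ} (h : IsHausdorffMomentSeq m) (k : ℕ) :
    IsHausdorffMomentSeq fun p => m p ^ k := by
  simpa using prod (range k) (m := fun _ => m) fun _ _ => h

/-- Probability measures on `[0, 1]` are weakly compact, and each monomial is a bounded continuous
test function, so a limit along an ultrafilter has the limiting moments. -/
theorem of_tendsto {f : ℕ → ℕ → ℝ} {m : ℕ → ℝ} (hf : ∀ n, IsHausdorffMomentSeq (f n))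
    (hm : ∀ p, Tendsto (fun n => f n p) atTop (𝓝 (m p))) : IsHausdorffMomentSeq m := by
  choose μ hμ using hf
  obtain ⟨ν, -, hν⟩ := isCompact_univ.ultrafilter_le_nhds ((hyperfilter ℕ).map μ) (by simp)
  have hν' : Tendsto μ (hyperfilter ℕ : Filter ℕ) (𝓝 ν) := hν
  refine ⟨ν, fun p => ?_⟩
  let g : BoundedContinuousFunction unitInterval ℝ :=
    BoundedContinuousFunction.mkOfCompact ⟨fun x : unitInterval => (x : ℝ) ^ p, by fun_prop⟩
  have h1 := (ProbabilityMeasure.tendsto_iff_forall_integral_tendsto.1 hν') g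
  have h2 : Tendsto (fun n => ∫ x, g x ∂(μ n : Measure unitInterval)) (hyperfilter ℕ : Filter ℕ)
      (𝓝 (m p)) := by
    have : (fun n => ∫ x, g x ∂(μ n : Measure unitInterval)) = fun n => f n p :=
      funext fun n => hμ n p
    rw [this]
    exact (hm p).mono_left Nat.hyperfilter_le_atTop
  exact tendsto_nhds_unique h1 h2

/-- Mixture of `μ` with weight `a` and a point mass at `1` with weight `1 - a`. -/
theorem convexComb_one {m : ℕ → ℝ} (h : IsHausdorffMomentSeq m) {a : ℝ} (ha0 : 0 ≤ a)
    (ha1 : a ≤ 1) : IsHausdorffMomentSeq fun p => 1 + a * (m p - 1) := by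
  obtain ⟨μ, hμ⟩ := h
  let ρ : Measure unitInterval :=
    ENNReal.ofReal a • (μ : Measure unitInterval) + ENNReal.ofReal (1 - a) • Measure.dirac 1
  have hρ : IsProbabilityMeasure ρ := ⟨by
    simp only [ρ, Measure.add_apply, Measure.smul_apply, measure_univ, smul_eq_mul, mul_one]
    rw [← ENNReal.ofReal_add ha0 (by linarith)]
    simp⟩
  have hi : ∀ (p : ℕ) (κ : Measure unitInterval) [IsFiniteMeasure κ],
      Integrable (fun x : unitInterval => (x : ℝ) ^ p) κ := fun p κ _ =>
    (by fun_prop : Continuous fun x : unitInterval => (x : ℝ) ^ p).integrable_of_hasCompactSupport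
      (HasCompactSupport.of_compactSpace _)
  refine ⟨⟨ρ, hρ⟩, fun p => ?_⟩
  simp only [ProbabilityMeasure.coe_mk, ρ]
  rw [integral_add_measure ((hi p _).smul_measure (by simp)) ((hi p _).smul_measure (by simp)),
    integral_smul_measure, integral_smul_measure, hμ, integral_dirac,
    ENNReal.toReal_ofReal ha0, ENNReal.toReal_ofReal (by linarith)]
  simp
  ring

/-- Poissonization: the limit of `(1 + l (m p - 1) / n) ^ n`, each term being a power of a mixture
with the point mass at `1`. -/
theorem exp {m : ℕ → ℝ} (h : IsHausdorffMomentSeq m) {l : ℝ} (hl : 0 ≤ l) :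
    IsHausdorffMomentSeq fun p => Real.exp (l * (m p - 1)) := by
  -- Shifting the index by `K > l` keeps the mixture weight `l / (n + K)` at most `1`.
  obtain ⟨K, hK⟩ := exists_nat_gt l
  refine of_tendsto (f := fun n p => (1 + l * (m p - 1) / ((n + K : ℕ) : ℝ)) ^ (n + K)) ?_ ?_
  · intro n
    have hn : l ≤ ((n + K : ℕ) : ℝ) := by push_cast; linarith [(n.cast_nonneg : (0 : ℝ) ≤ n)]
    have := (h.convexComb_one (a := l / ((n + K : ℕ) : ℝ)) (by positivity)
      (div_le_one_of_le₀ hn (by positivity))).pow (n + K)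
    convert this using 4
    ring
  · intro p
    exact (tendsto_add_atTop_iff_nat K
      (f := fun n : ℕ => (1 + l * (m p - 1) / (n : ℝ)) ^ n)).2 (Real.tendsto_one_add_div_pow_exp _)

/-- These are the moments of `u ^ (1 / d)` for `u` uniform on `(0, 1]`. -/
theorem div_add {d : ℝ} (hd : 0 < d) : IsHausdorffMomentSeq fun p => d / (d + p) := by
  let g : ℝ → unitInterval := fun u => Set.projIcc 0 1 zero_le_one (u ^ (1 / d))
  have hg : Measurable g := by
    have : Measurable fun u : ℝ => u ^ (1 / d) := by fun_prop
    exact continuous_projIcc.measurable.comp this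
  have hP : IsProbabilityMeasure ((volume : Measure ℝ).restrict (Set.Ioc 0 1)) := ⟨by simp⟩
  refine ⟨⟨((volume : Measure ℝ).restrict (Set.Ioc 0 1)).map g,
    Measure.isProbabilityMeasure_map hg.aemeasurable⟩, fun p => ?_⟩
  simp only [ProbabilityMeasure.coe_mk]
  rw [integral_map hg.aemeasurable (by fun_prop)]
  have : ∀ u ∈ Set.Ioc (0 : ℝ) 1, ((g u : unitInterval) : ℝ) ^ p = u ^ (p / d) := by
    intro u hu
    have h1 : u ^ (1 / d) ∈ Set.Icc (0 : ℝ) 1 :=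
      ⟨Real.rpow_nonneg hu.1.le _, Real.rpow_le_one hu.1.le hu.2 (by positivity)⟩
    simp only [g]
    rw [Set.projIcc_of_mem zero_le_one h1, ← Real.rpow_natCast, ← Real.rpow_mul hu.1.le]
    congr 1
    ring
  rw [setIntegral_congr_fun measurableSet_Ioc this, ← intervalIntegral.integral_of_le zero_le_one,
    integral_rpow (Or.inl (by have : (0 : ℝ) ≤ p / d := by positivity
                              linarith)), Real.one_rpow, Real.zero_rpow (by positivity)]
  field_simp
  ring

/-- The real powers of the moments of a mixture of a point mass at `1` and a power law. -/
theorem ratio_rpow {c d t : ℝ} (hc : 0 < c) (hcd : c ≤ d) (ht : 0 ≤ t) :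
    IsHausdorffMomentSeq fun p => (c * (d + p) / (d * (c + p))) ^ t := by
  have hd : 0 < d := hc.trans_le hcd
  set r : ℝ := 1 - c / d with hr
  have hr0 : 0 ≤ r := by rw [hr, sub_nonneg]; exact div_le_one_of_le₀ hcd hd.le
  have hr1 : r < 1 := by rw [hr]; have : 0 < c / d := by positivity
                         linarith
  -- With `q = d / (d + p)` the ratio is `(1 - r) / (1 - r q)`, whose logarithm is `∑ r^(k+1) /
  -- (k+1) * (q^(k+1) - 1)`; the coefficients are nonnegative because `c ≤ d`.
  refine of_tendsto (f := fun n p => ∏ k ∈ range n,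
    Real.exp (t * r ^ (k + 1) / (k + 1) * ((d / (d + p)) ^ (k + 1) - 1))) ?_ ?_
  · intro n
    exact prod _ fun k _ => ((div_add hd).pow (k + 1)).exp (by positivity)
  · intro p
    have hdp : 0 < d + p := by positivity
    have hcp : 0 < c + p := by positivity
    have hq0 : 0 ≤ d / (d + p) := by positivity
    have hq1 : d / (d + p) ≤ 1 := div_le_one_of_le₀ (by simp) hdp.le
    have s1 := Real.hasSum_pow_div_log_of_abs_lt_one (x := r) (by rwa [abs_of_nonneg hr0])
    have s2 := Real.hasSum_pow_div_log_of_abs_lt_one (x := r * (d / (d + p)))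
      (by rw [abs_of_nonneg (by positivity)]; nlinarith)
    have s := ((s2.sub s1).mul_left t).tendsto_sum_nat
    simp_rw [← Real.exp_sum]
    have e : (c * (d + p) / (d * (c + p))) ^ t =
        Real.exp (t * (-Real.log (1 - r * (d / (d + p))) - -Real.log (1 - r))) := by
      have e1 : 1 - r * (d / (d + p)) = (c + p) / (d + p) := by rw [hr]; field_simp; ring
      have e2 : 1 - r = c / d := by rw [hr]; ring
      rw [e1, e2, Real.rpow_def_of_pos (by positivity), mul_comm]
      congr 2
      rw [Real.log_div (by positivity) (by positivity), Real.log_div (by positivity) (by positivity),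
        Real.log_div (by positivity) (by positivity), Real.log_mul (by positivity) (by positivity),
        Real.log_mul (by positivity) (by positivity)]
      ring
    rw [e]
    refine (Real.continuous_exp.tendsto _).comp (s.congr fun n => sum_congr rfl fun k _ => ?_)
    rw [mul_pow]
    ring

end IsHausdorffMomentSeq

/-! ### Rising factorials and real powers of Beta moments. -/

/-- The rising factorial `a (a + 1) ⋯ (a + p - 1)` of a real number. -/
def risingFactorial (a : ℝ) (p : ℕ) : ℝ := ∏ i ∈ range p, (a + i)

theorem risingFactorial_pos {a : ℝ} (ha : 0 < a) (p : ℕ) : 0 < risingFactorial a p :=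
  prod_pos fun _ _ => by positivity

theorem risingFactorial_succ (a : ℝ) (p : ℕ) :
    risingFactorial a (p + 1) = risingFactorial a p * (a + p) := prod_range_succ _ _

theorem risingFactorial_succ' (a : ℝ) (p : ℕ) :
    risingFactorial a (p + 1) = a * risingFactorial (a + 1) p := by
  rw [risingFactorial, prod_range_succ', mul_comm, risingFactorial]
  simp only [Nat.cast_zero, add_zero, Nat.cast_succ]
  congr 1
  exact prod_congr rfl fun i _ => by ring

/-- Telescoping: with `(x)_p` the rising factorial, `(x)_p / (x + 1)_p = x / (x + p)`, applied at `x
= a + k` and, inverted, at `x = a + b + k`. -/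
theorem prod_ratio_eq_risingFactorial {a b : ℝ} (ha : 0 < a) (hb : 0 ≤ b) (p K : ℕ) :
    ∏ k ∈ range K, (a + k) * (a + b + k + p) / ((a + b + k) * (a + k + p)) =
      risingFactorial a p / risingFactorial (a + b) p *
        (risingFactorial (a + b + K) p / risingFactorial (a + K) p) := by
  have pos : ∀ x : ℝ, 0 < x → risingFactorial x p ≠ 0 := fun x hx => (risingFactorial_pos hx p).ne'
  induction K with
  | zero =>
    have h1 := pos a ha
    have h2 := pos (a + b) (by positivity)
    simp
    field_simp
  | succ K ih =>
    have key : ∀ x : ℝ, 0 < x →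
        risingFactorial (x + ↑(K + 1)) p = risingFactorial (x + K) p * (x + K + p) / (x + K) := by
      intro x hx
      have hx' : x + (K : ℝ) ≠ 0 := by positivity
      rw [eq_div_iff hx', ← risingFactorial_succ, risingFactorial_succ']
      push_cast
      rw [← add_assoc, mul_comm]
    rw [prod_range_succ, ih, key a ha, key (a + b) (by positivity)]
    have h1 := pos (a + b) (by positivity)
    have h2 := pos (a + K) (by positivity)
    have h3 : a + (K : ℝ) ≠ 0 := by positivity
    have h4 : a + b + (K : ℝ) ≠ 0 := by positivity
    have h5 : a + K + (p : ℝ) ≠ 0 := by positivity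
    field_simp

theorem tendsto_risingFactorial_ratio {a b : ℝ} (p : ℕ) :
    Tendsto (fun K : ℕ => risingFactorial (a + b + K) p / risingFactorial (a + K) p)
      atTop (𝓝 1) := by
  simp only [risingFactorial, ← prod_div_distrib]
  rw [← prod_const_one (s := range p)]
  refine tendsto_finsetProd _ fun i _ => ?_
  have h : Tendsto (fun K : ℕ => a + (K : ℝ) + i) atTop atTop :=
    tendsto_atTop_add_const_right _ _ (tendsto_atTop_add_const_left _ _ tendsto_natCast_atTop_atTop)
  have h1 : Tendsto (fun K : ℕ => 1 + b / (a + (K : ℝ) + i)) atTop (𝓝 (1 + 0)) :=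
    tendsto_const_nhds.add (h.const_div_atTop b)
  rw [add_zero] at h1
  refine h1.congr' ?_
  filter_upwards [h.eventually_gt_atTop 0] with K hK
  field_simp
  ring

/-- Real powers of the moments of a Beta distribution. -/
theorem IsHausdorffMomentSeq.beta_rpow {a b t : ℝ} (ha : 0 < a) (hb : 0 ≤ b) (ht : 0 ≤ t) :
    IsHausdorffMomentSeq fun p => (risingFactorial a p / risingFactorial (a + b) p) ^ t := by
  -- The infinite product form of the Beta moment: each factor falls under `ratio_rpow` with `c = a
  -- + k`, `d = a + b + k`, and the telescoped remainder tends to `1`.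
  refine of_tendsto (f := fun K p => ∏ k ∈ range K,
    ((a + k) * (a + b + k + p) / ((a + b + k) * (a + k + p))) ^ t) ?_ ?_
  · exact fun K => prod _ fun k _ => ratio_rpow (by positivity) (by linarith) ht
  · intro p
    have hnn : ∀ k : ℕ, 0 ≤ (a + k) * (a + b + k + p) / ((a + b + k) * (a + k + p)) :=
      fun k => by positivity
    simp_rw [Real.finsetProd_rpow _ _ (fun k _ => hnn k), prod_ratio_eq_risingFactorial ha hb]
    have h := (tendsto_risingFactorial_ratio (a := a) (b := b) p).const_mul
      (risingFactorial a p / risingFactorial (a + b) p)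
    rw [mul_one] at h
    exact h.rpow_const (Or.inr ht)

/-- Duplication formula: it separates the even and odd factors. -/
theorem risingFactorial_two_mul (a : ℝ) (p : ℕ) :
    risingFactorial a (2 * p) =
      4 ^ p * (risingFactorial (a / 2) p * risingFactorial ((a + 1) / 2) p) := by
  induction p with
  | zero => simp [risingFactorial]
  | succ p ih =>
    rw [show 2 * (p + 1) = 2 * p + 1 + 1 by ring, risingFactorial_succ, risingFactorial_succ, ih,
      risingFactorial_succ, risingFactorial_succ]
    push_cast
    ring

/-- Duplication yields the moments of Beta(`a/2`, `a/2`) times those of Beta(`(a+1)/2`, `(a-1)/2`);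
`1 ≤ a` makes the last parameter nonnegative. -/
theorem IsHausdorffMomentSeq.duplication_rpow {a t : ℝ} (ha : 1 ≤ a) (ht : 0 ≤ t) :
    IsHausdorffMomentSeq fun p =>
      (risingFactorial a (2 * p) / risingFactorial a p ^ 2 / 4 ^ p) ^ t := by
  have h1 := beta_rpow (a := a / 2) (b := a / 2) (by positivity) (by positivity) ht
  have h2 := beta_rpow (a := (a + 1) / 2) (b := (a - 1) / 2) (by positivity) (by linarith) ht
  convert h1.mul h2 using 2 with p
  have pos : ∀ x : ℝ, 0 < x → 0 < risingFactorial x p := fun x hx => risingFactorial_pos hx p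
  have p1 := pos a (by linarith)
  have p2 := pos (a / 2) (by linarith)
  have p3 := pos ((a + 1) / 2) (by linarith)
  rw [show a / 2 + a / 2 = a by ring, show (a + 1) / 2 + (a - 1) / 2 = a by ring,
    ← Real.mul_rpow (by positivity) (by positivity), risingFactorial_two_mul]
  congr 1
  field_simp

/-! ### Moment determinacy on `[0, 1]`. -/

/-- A probability measure on `[0, 1]` is determined by its moments. -/
theorem unitInterval_measure_ext_of_moments {μ ν : Measure unitInterval} [IsProbabilityMeasure μ]
    [IsProbabilityMeasure ν] (h : ∀ p : ℕ, ∫ x, (x : ℝ) ^ p ∂μ = ∫ x, (x : ℝ) ^ p ∂ν) : μ = ν := by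
  have hi : ∀ (κ : Measure unitInterval) [IsProbabilityMeasure κ] (f : C(unitInterval, ℝ)),
      Integrable f κ := fun κ _ f =>
    f.continuous.integrable_of_hasCompactSupport (HasCompactSupport.of_compactSpace _)
  have hcont : ∀ (κ : Measure unitInterval) [IsProbabilityMeasure κ],
      Continuous fun f : C(unitInterval, ℝ) => ∫ x, f x ∂κ := by
    intro κ _
    refine LipschitzWith.continuous (K := 1) (LipschitzWith.of_dist_le_mul fun f g => ?_)
    rw [dist_eq_norm, dist_eq_norm, ← integral_sub (hi κ f) (hi κ g)]
    refine (norm_integral_le_of_norm_le_const (C := ‖f - g‖) (ae_of_all _ fun x => ?_)).trans ?_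
    · exact (f - g).norm_coe_le_norm x
    · simp
  -- Weierstrass: the functions with equal integrals form a closed set containing the polynomials,
  -- hence everything.
  have hclosed : IsClosed {f : C(unitInterval, ℝ) | ∫ x, f x ∂μ = ∫ x, f x ∂ν} :=
    isClosed_eq (hcont μ) (hcont ν)
  have hsub : (polynomialFunctions unitInterval : Set C(unitInterval, ℝ)) ⊆
      {f : C(unitInterval, ℝ) | ∫ x, f x ∂μ = ∫ x, f x ∂ν} := by
    rintro _ ⟨q, -, rfl⟩
    have hq : ∀ (κ : Measure unitInterval) [IsProbabilityMeasure κ],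
        ∫ x : unitInterval, q.eval (x : ℝ) ∂κ =
          ∑ k ∈ range (q.natDegree + 1), q.coeff k * ∫ x : unitInterval, (x : ℝ) ^ k ∂κ := by
      intro κ _
      simp_rw [Polynomial.eval_eq_sum_range]
      rw [integral_finsetSum _ fun k _ => (hi κ ⟨fun x => (x : ℝ) ^ k, by fun_prop⟩).const_mul _]
      exact sum_congr rfl fun k _ => integral_const_mul _ _
    change ∫ x : unitInterval, q.eval (x : ℝ) ∂μ = ∫ x : unitInterval, q.eval (x : ℝ) ∂ν
    rw [hq μ, hq ν]
    exact sum_congr rfl fun k _ => by rw [h]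
  have hall := hclosed.closure_subset_iff.2 hsub
  rw [← Subalgebra.topologicalClosure_coe, polynomialFunctions_closure_eq_top'] at hall
  refine ext_of_forall_integral_eq_of_IsFiniteMeasure fun f => ?_
  exact hall (Set.mem_univ f.toContinuousMap)

/-! ### Splitting off one dimension: block matrices and complex reflections. -/

/-- The block diagonal matrix `1 ⊕ W`. -/
def oneSum {N : ℕ} (W : Matrix (Fin N) (Fin N) ℂ) : Matrix (Fin (N + 1)) (Fin (N + 1)) ℂ :=
  Matrix.of (Fin.cons (Fin.cons 1 fun _ => 0) fun i => Fin.cons 0 (W i))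

section oneSum

variable {N : ℕ} (W W' : Matrix (Fin N) (Fin N) ℂ)

@[simp] theorem oneSum_zero_zero : oneSum W 0 0 = 1 := rfl
@[simp] theorem oneSum_zero_succ (j : Fin N) : oneSum W 0 j.succ = 0 := rfl
@[simp] theorem oneSum_succ_zero (i : Fin N) : oneSum W i.succ 0 = 0 := rfl
@[simp] theorem oneSum_succ_succ (i j : Fin N) : oneSum W i.succ j.succ = W i j := rfl

theorem oneSum_one : oneSum (1 : Matrix (Fin N) (Fin N) ℂ) = 1 := by
  ext i j
  refine Fin.cases ?_ (fun i => ?_) i <;> refine Fin.cases ?_ (fun j => ?_) j <;>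
    simp [Matrix.one_apply, Fin.succ_ne_zero, (Fin.succ_ne_zero _).symm]

theorem oneSum_mul : oneSum (W * W') = oneSum W * oneSum W' := by
  ext i j
  refine Fin.cases ?_ (fun i => ?_) i <;> refine Fin.cases ?_ (fun j => ?_) j <;>
    simp [Matrix.mul_apply, Fin.sum_univ_succ]

theorem oneSum_star : oneSum (star W) = star (oneSum W) := by
  ext i j
  refine Fin.cases ?_ (fun i => ?_) i <;> refine Fin.cases ?_ (fun j => ?_) j <;>
    simp [Matrix.star_apply]

variable {W} in
theorem oneSum_mem_unitaryGroup (hW : W ∈ Matrix.unitaryGroup (Fin N) ℂ) :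
    oneSum W ∈ Matrix.unitaryGroup (Fin (N + 1)) ℂ := by
  rw [Matrix.mem_unitaryGroup_iff, ← oneSum_star, ← oneSum_mul, Matrix.mem_unitaryGroup_iff.1 hW,
    oneSum_one]

theorem continuous_oneSum : Continuous (oneSum : Matrix (Fin N) (Fin N) ℂ → _) := by
  refine continuous_matrix fun i j => ?_
  refine Fin.cases ?_ (fun i => ?_) i <;> refine Fin.cases ?_ (fun j => ?_) j <;>
    simp only [oneSum_zero_zero, oneSum_zero_succ, oneSum_succ_zero, oneSum_succ_succ] <;> fun_prop

/-- A rank one perturbation of `1 - (1 ⊕ W)` has determinant proportional to `det (1 - W)`. -/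
theorem det_one_sub_oneSum_add_vecMulVec (k l : Fin (N + 1) → ℂ) (hl : l 0 = 1) :
    (1 - oneSum W + Matrix.vecMulVec k l).det = k 0 * (1 - W).det := by
  have h0 : ∀ i, (1 - oneSum W) i 0 = 0 := fun i => by
    refine Fin.cases ?_ (fun i => ?_) i <;> simp
  -- Column `0` of `1 - oneSum W` vanishes, so column `0` of the perturbation is `k`; subtracting `l
  -- j` times it clears the rank one term from every other column.
  have hB : (1 - oneSum W + Matrix.vecMulVec k l).det = ((1 - oneSum W).updateCol 0 k).det := by
    rw [← Matrix.det_transpose, ← Matrix.det_transpose ((1 - oneSum W).updateCol 0 k)]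
    refine Matrix.det_eq_of_forall_row_eq_smul_add_const (fun j => if j = 0 then 0 else l j) 0
      (by simp) fun j i => ?_
    simp only [Matrix.transpose_apply]
    by_cases hj : j = 0
    · subst hj
      simp only [Matrix.add_apply, h0, Matrix.vecMulVec_apply, hl]
      simp
    · simp only [Matrix.add_apply, Matrix.vecMulVec_apply, Matrix.updateCol_ne hj,
        Matrix.updateCol_self, if_neg hj]
      ring
  have h1 : ((1 - oneSum W).updateCol 0 k).submatrix Fin.succ (Fin.succAbove 0) = 1 - W := by
    ext i j
    simp [Matrix.one_apply]
  rw [hB, Matrix.det_succ_row_zero, Fin.sum_univ_succ, h1, sum_eq_zero fun j _ => ?_]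
  · simp
  · simp [(Fin.succ_ne_zero j).symm]

end oneSum

/-- The embedding `W ↦ 1 ⊕ W` of `U(N)` into `U(N + 1)`. -/
def unitaryOneSum {N : ℕ} (W : Matrix.unitaryGroup (Fin N) ℂ) :
    Matrix.unitaryGroup (Fin (N + 1)) ℂ :=
  ⟨oneSum W, oneSum_mem_unitaryGroup W.2⟩

theorem continuous_unitaryOneSum {N : ℕ} : Continuous (unitaryOneSum (N := N)) :=
  (continuous_oneSum.comp continuous_subtype_val).subtype_mk _

theorem unitary_sum_col {N : ℕ} {V : Matrix (Fin N) (Fin N) ℂ}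
    (hV : V ∈ Matrix.unitaryGroup (Fin N) ℂ) (j : Fin N) : ∑ i, ‖V i j‖ ^ 2 = 1 := by
  have h := congrFun (congrFun (Matrix.mem_unitaryGroup_iff'.1 hV) j) j
  simp only [Matrix.mul_apply, Matrix.star_apply, Matrix.one_apply_eq, RCLike.star_def,
    Complex.conj_mul'] at h
  exact_mod_cast h

/-- A unitary matrix with upper left entry `1` is of the form `1 ⊕ W`. -/
theorem exists_unitaryOneSum_eq {N : ℕ} (V : Matrix.unitaryGroup (Fin (N + 1)) ℂ)
    (hV : (V : Matrix (Fin (N + 1)) (Fin (N + 1)) ℂ) 0 0 = 1) : ∃ W, V = unitaryOneSum W := by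
  have col : ∀ V : Matrix (Fin (N + 1)) (Fin (N + 1)) ℂ,
      V ∈ Matrix.unitaryGroup (Fin (N + 1)) ℂ → V 0 0 = 1 → ∀ i : Fin N, V i.succ 0 = 0 := by
    intro V h h1 i
    have h2 := unitary_sum_col h 0
    rw [Fin.sum_univ_succ, h1] at h2
    have h3 : ∑ i : Fin N, ‖V i.succ 0‖ ^ 2 = 0 := by simpa using h2
    have h4 := (sum_eq_zero_iff_of_nonneg fun i _ => by positivity).1 h3 i (mem_univ i)
    simpa using h4
  have hc := col V V.2 hV
  have hr : ∀ j : Fin N, (V : Matrix (Fin (N + 1)) (Fin (N + 1)) ℂ) 0 j.succ = 0 := by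
    intro j
    have := col (star V : Matrix.unitaryGroup (Fin (N + 1)) ℂ) (star V).2
      (by simp [Matrix.star_apply, hV]) j
    simpa [Matrix.star_apply] using this
  let W : Matrix (Fin N) (Fin N) ℂ := (V : Matrix (Fin (N + 1)) (Fin (N + 1)) ℂ).submatrix
    Fin.succ Fin.succ
  have hW : (V : Matrix (Fin (N + 1)) (Fin (N + 1)) ℂ) = oneSum W := by
    ext i j
    refine Fin.cases ?_ (fun i => ?_) i <;> refine Fin.cases ?_ (fun j => ?_) j <;>
      simp [hV, hc, hr, W]
  have hWu : W ∈ Matrix.unitaryGroup (Fin N) ℂ := by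
    have h := Matrix.mem_unitaryGroup_iff.1 V.2
    rw [hW, ← oneSum_star, ← oneSum_mul] at h
    rw [Matrix.mem_unitaryGroup_iff]
    ext i j
    have := congrFun (congrFun h i.succ) j.succ
    simpa [Matrix.one_apply] using this
  exact ⟨⟨W, hWu⟩, Subtype.ext hW⟩

/-- The complex reflection mapping the first basis vector to a given unit vector. -/
theorem exists_complexReflection {N : ℕ} (v : Fin (N + 1) → ℂ) (hv : ∑ i, ‖v i‖ ^ 2 = 1)
    (hv1 : v 0 ≠ 1) : ∃ (M : Matrix.unitaryGroup (Fin (N + 1)) ℂ) (k l : Fin (N + 1) → ℂ),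
      (M : Matrix (Fin (N + 1)) (Fin (N + 1)) ℂ) = 1 - Matrix.vecMulVec k l ∧ l 0 = 1 ∧
      k 0 = 1 - v 0 ∧ ∀ i, (M : Matrix (Fin (N + 1)) (Fin (N + 1)) ℂ) i 0 = v i := by
  set k : Fin (N + 1) → ℂ := fun i => (if i = 0 then 1 else 0) - v i with hk
  -- This scalar makes `l 0 = 1`. Unitarity of `1 - a k k*` then amounts to `k* k = k 0 + star (k
  -- 0)`, which holds because `v` is a unit vector.
  set a : ℂ := (star (k 0))⁻¹ with ha
  have hk0 : k 0 = 1 - v 0 := by simp [hk]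
  have hk0' : k 0 ≠ 0 := by rw [hk0, sub_ne_zero]; exact hv1.symm
  have hak : a * star (k 0) = 1 := inv_mul_cancel₀ (by simpa using hk0')
  have hkk : star k ⬝ᵥ k = k 0 + star (k 0) := by
    have hv' : ∑ i : Fin N, star (v i.succ) * v i.succ = 1 - star (v 0) * v 0 := by
      rw [Fin.sum_univ_succ] at hv
      simp only [RCLike.star_def, Complex.conj_mul']
      rw [eq_sub_iff_add_eq, add_comm]
      exact_mod_cast hv
    rw [dotProduct, Fin.sum_univ_succ, hk0]
    have : ∀ i : Fin N, star k i.succ * k i.succ = star (v i.succ) * v i.succ := by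
      intro i
      simp [hk, Fin.succ_ne_zero]
    rw [sum_congr rfl fun i _ => this i, hv', Pi.star_apply, hk0]
    simp only [star_sub, star_one]
    ring
  have hmul : Matrix.vecMulVec k (star k) * Matrix.vecMulVec k (star k) =
      (k 0 + star (k 0)) • Matrix.vecMulVec k (star k) := by
    rw [Matrix.vecMulVec_mul_vecMulVec, hkk]
    ext i j
    simp [Matrix.vecMulVec_apply]
    ring
  have hM : 1 - Matrix.vecMulVec k (a • star k) ∈ Matrix.unitaryGroup (Fin (N + 1)) ℂ := by
    have e1 : Matrix.vecMulVec k (a • star k) = a • Matrix.vecMulVec k (star k) := by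
      ext i j
      simp [Matrix.vecMulVec_apply]
      ring
    have e2 : star (Matrix.vecMulVec k (star k)) = Matrix.vecMulVec k (star k) := by
      ext i j
      simp [Matrix.vecMulVec_apply, Matrix.star_apply]
      ring
    have e3 : a * star a * (k 0 + star (k 0)) = a + star a := by
      have h := congrArg star hak
      simp only [star_mul, star_star, star_one] at h
      linear_combination (a * h + star a * hak)
    rw [Matrix.mem_unitaryGroup_iff, e1, star_sub, star_one, star_smul, e2, sub_mul, mul_sub, mul_sub,
      smul_mul_smul_comm, hmul, smul_smul, e3]
    simp only [mul_one, one_mul, add_smul]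
    abel
  refine ⟨⟨_, hM⟩, k, a • star k, rfl, by simpa using hak, hk0, fun i => ?_⟩
  change (1 : Matrix (Fin (N + 1)) (Fin (N + 1)) ℂ) i 0 - k i * (a * star (k 0)) = v i
  rw [hak, Matrix.one_apply, hk]
  ring

/-- The characteristic polynomial at `1` of `V (1 ⊕ U)` factors through the upper left entry of
`V` and the characteristic polynomial of a left translate of `U`. -/
theorem exists_det_one_sub_mul_unitaryOneSum {N : ℕ} (V : Matrix.unitaryGroup (Fin (N + 1)) ℂ) :
    ∃ W : Matrix.unitaryGroup (Fin N) ℂ, ∀ U : Matrix.unitaryGroup (Fin N) ℂ,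
      (1 - ((V * unitaryOneSum U : Matrix.unitaryGroup (Fin (N + 1)) ℂ) :
        Matrix (Fin (N + 1)) (Fin (N + 1)) ℂ)).det =
      (1 - (V : Matrix (Fin (N + 1)) (Fin (N + 1)) ℂ) 0 0) *
        (1 - ((W * U : Matrix.unitaryGroup (Fin N) ℂ) : Matrix (Fin N) (Fin N) ℂ)).det := by
  by_cases h : (V : Matrix (Fin (N + 1)) (Fin (N + 1)) ℂ) 0 0 = 1
  -- Degenerate case, where no reflection is available: both sides are zero.
  · obtain ⟨W, rfl⟩ := exists_unitaryOneSum_eq V h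
    refine ⟨W, fun U => ?_⟩
    rw [h, sub_self, zero_mul]
    have : ((unitaryOneSum W * unitaryOneSum U : Matrix.unitaryGroup (Fin (N + 1)) ℂ) :
        Matrix (Fin (N + 1)) (Fin (N + 1)) ℂ) = oneSum (W * U) := (oneSum_mul _ _).symm
    rw [this]
    refine Matrix.det_eq_zero_of_column_eq_zero 0 fun i => ?_
    refine Fin.cases ?_ (fun i => ?_) i <;> simp
  -- `M` shares its first column with `V`, so `star M * V` has corner entry `1` and `V = M (1 ⊕ W)`.
  · obtain ⟨M, k, l, hM, hl, hk, hcol⟩ := exists_complexReflection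
      (fun i => (V : Matrix (Fin (N + 1)) (Fin (N + 1)) ℂ) i 0) (unitary_sum_col V.2 0) h
    have h00 : ((star M * V : Matrix.unitaryGroup (Fin (N + 1)) ℂ) :
        Matrix (Fin (N + 1)) (Fin (N + 1)) ℂ) 0 0 = 1 := by
      have := unitary_sum_col V.2 0
      simp only [Submonoid.coe_mul, Matrix.mul_apply, Unitary.coe_star, Matrix.star_apply, hcol,
        RCLike.star_def, Complex.conj_mul']
      exact_mod_cast this
    obtain ⟨W, hW⟩ := exists_unitaryOneSum_eq _ h00
    have hV : V = M * unitaryOneSum W := by rw [← hW, ← mul_assoc, Unitary.mul_star_self, one_mul]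
    refine ⟨W, fun U => ?_⟩
    rw [← hk, ← det_one_sub_oneSum_add_vecMulVec _ k
      (Matrix.vecMul l (oneSum (W * U : Matrix (Fin N) (Fin N) ℂ)))]
    · congr 1
      have : ((V * unitaryOneSum U : Matrix.unitaryGroup (Fin (N + 1)) ℂ) :
          Matrix (Fin (N + 1)) (Fin (N + 1)) ℂ) =
          (1 - Matrix.vecMulVec k l) * oneSum (W * U : Matrix (Fin N) (Fin N) ℂ) := by
        rw [hV, oneSum_mul, ← hM, ← mul_assoc]
        rfl
      rw [this, sub_mul, one_mul, Matrix.vecMulVec_mul]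
      simp only [Submonoid.coe_mul]
      abel
    · rw [Matrix.vecMul, dotProduct, Fin.sum_univ_succ]
      simp [hl]

/-! ### Haar invariance and the recursion of the moments in `N`. -/

theorem haarUnitary_integral_mul_left {N : ℕ} {E : Type*} [NormedAddCommGroup E] [NormedSpace ℝ E]
    (f : Matrix.unitaryGroup (Fin N) ℂ → E) (g : Matrix.unitaryGroup (Fin N) ℂ) :
    ∫ V, f (g * V) ∂haarUnitary N = ∫ V, f V ∂haarUnitary N :=
  integral_mul_left_eq_self f g

instance haarUnitary_isMulRightInvariant (N : ℕ) : (haarUnitary N).IsMulRightInvariant where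
  map_mul_right_eq_self g := by
    have : IsProbabilityMeasure ((haarUnitary N).map (· * g)) :=
      Measure.isProbabilityMeasure_map (by fun_prop)
    exact Measure.isHaarMeasure_eq_of_isProbabilityMeasure _ _

theorem Continuous.integrable_haarUnitary {N : ℕ} {E : Type*} [NormedAddCommGroup E]
    {f : Matrix.unitaryGroup (Fin N) ℂ → E} (hf : Continuous f) : Integrable f (haarUnitary N) :=
  hf.integrable_of_hasCompactSupport (HasCompactSupport.of_compactSpace _)

/-- Averaging over `V (1 ⊕ U)` costs nothing by right invariance. After Fubini the determinant
factors, and left invariance on `U(N)` absorbs the `V`-dependent `W`. -/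
theorem integral_norm_det_pow_succ (N p : ℕ) :
    ∫ V, ‖(1 - (V : Matrix (Fin (N + 1)) (Fin (N + 1)) ℂ)).det‖ ^ p ∂haarUnitary (N + 1) =
      (∫ V, ‖1 - (V : Matrix (Fin (N + 1)) (Fin (N + 1)) ℂ) 0 0‖ ^ p ∂haarUnitary (N + 1)) *
        ∫ U, ‖(1 - (U : Matrix (Fin N) (Fin N) ℂ)).det‖ ^ p ∂haarUnitary N := by
  set f : Matrix.unitaryGroup (Fin (N + 1)) ℂ → ℝ := fun V =>
    ‖(1 - (V : Matrix (Fin (N + 1)) (Fin (N + 1)) ℂ)).det‖ ^ p with hf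
  have hfc : Continuous f :=
    ((continuous_const.sub continuous_subtype_val).matrix_det).norm.pow p
  calc ∫ V, f V ∂haarUnitary (N + 1)
      = ∫ U, ∫ V, f (V * unitaryOneSum U) ∂haarUnitary (N + 1) ∂haarUnitary N := by
        simp [integral_mul_right_eq_self]
    _ = ∫ V, ∫ U, f (V * unitaryOneSum U) ∂haarUnitary N ∂haarUnitary (N + 1) := by
        refine integral_integral_swap_of_hasCompactSupport ?_ (HasCompactSupport.of_compactSpace _)
        exact hfc.comp (continuous_snd.mul (continuous_unitaryOneSum.comp continuous_fst))
    _ = ∫ V, ‖1 - (V : Matrix (Fin (N + 1)) (Fin (N + 1)) ℂ) 0 0‖ ^ p *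
          (∫ U, ‖(1 - (U : Matrix (Fin N) (Fin N) ℂ)).det‖ ^ p ∂haarUnitary N)
          ∂haarUnitary (N + 1) := by
        congr 1 with V
        obtain ⟨W, hW⟩ := exists_det_one_sub_mul_unitaryOneSum V
        simp only [hf, hW, norm_mul, mul_pow]
        rw [integral_const_mul, haarUnitary_integral_mul_left
          (fun U => ‖(1 - (U : Matrix (Fin N) (Fin N) ℂ)).det‖ ^ p) W]
    _ = _ := integral_mul_const _ _

/-! ### Phase symmetry and the moments of the corner entry. -/

/-- The diagonal unitary matrix with entry `u` at place `j` and all other entries `1`. -/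
def unitaryPhase {N : ℕ} (j : Fin N) (u : Circle) : Matrix.unitaryGroup (Fin N) ℂ :=
  ⟨Matrix.diagonal fun i => if i = j then (u : ℂ) else 1, by
    rw [Matrix.mem_unitaryGroup_iff, Matrix.star_eq_conjTranspose, Matrix.diagonal_conjTranspose,
      Matrix.diagonal_mul_diagonal, ← Matrix.diagonal_one]
    congr 1
    ext i
    by_cases h : i = j <;> simp [h, Complex.mul_conj', Circle.norm_coe]⟩

theorem unitaryPhase_mul_apply {N : ℕ} (j : Fin N) (u : Circle)
    (V : Matrix.unitaryGroup (Fin N) ℂ) (i k : Fin N) :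
    ((unitaryPhase j u * V : Matrix.unitaryGroup (Fin N) ℂ) : Matrix (Fin N) (Fin N) ℂ) i k =
      (if i = j then (u : ℂ) else 1) * (V : Matrix (Fin N) (Fin N) ℂ) i k := by
  simp [unitaryPhase, Matrix.diagonal_mul]

theorem exists_circle_pow_mul_conj_pow_eq_neg_one {k l : ℕ} (h : k ≠ l) :
    ∃ u : Circle, (u : ℂ) ^ k * conj (u : ℂ) ^ l = -1 := by
  have hkl : ((k : ℂ) - l) ≠ 0 := sub_ne_zero.2 (by exact_mod_cast h)
  refine ⟨Circle.exp (Real.pi / (k - l)), ?_⟩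
  rw [Circle.coe_exp, ← Complex.exp_conj, ← Complex.exp_nat_mul, ← Complex.exp_nat_mul,
    ← Complex.exp_add, ← Complex.exp_pi_mul_I]
  congr 1
  simp
  field_simp
  ring

theorem continuous_unitary_apply {N : ℕ} (i j : Fin N) :
    Continuous fun V : Matrix.unitaryGroup (Fin N) ℂ => (V : Matrix (Fin N) (Fin N) ℂ) i j :=
  continuous_subtype_val.matrix_elem i j

/-- Orthogonality of the powers of an entry of a Haar unitary matrix and their conjugates, against
functions that do not depend on the phase of the row. -/
theorem integral_sum_unitary_apply_pow_mul_conj {N : ℕ} (i j : Fin N) (s : Finset ℕ)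
    (G : ℕ → ℕ → Matrix.unitaryGroup (Fin N) ℂ → ℂ) (hG : ∀ k l, Continuous (G k l))
    (hGu : ∀ k l u V, G k l (unitaryPhase i u * V) = G k l V) :
    ∫ V : Matrix.unitaryGroup (Fin N) ℂ, ∑ k ∈ s, ∑ l ∈ s, G k l V *
        ((V : Matrix (Fin N) (Fin N) ℂ) i j ^ k * conj ((V : Matrix (Fin N) (Fin N) ℂ) i j) ^ l)
        ∂haarUnitary N =
      ∑ k ∈ s, ∫ V : Matrix.unitaryGroup (Fin N) ℂ, G k k V *
        ((V : Matrix (Fin N) (Fin N) ℂ) i j * conj ((V : Matrix (Fin N) (Fin N) ℂ) i j)) ^ k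
        ∂haarUnitary N := by
  have hc : ∀ k l, Continuous fun V : Matrix.unitaryGroup (Fin N) ℂ => G k l V *
      ((V : Matrix (Fin N) (Fin N) ℂ) i j ^ k *
        conj ((V : Matrix (Fin N) (Fin N) ℂ) i j) ^ l) := fun k l =>
    (hG k l).mul (((continuous_unitary_apply i j).pow k).mul
      ((Complex.continuous_conj.comp (continuous_unitary_apply i j)).pow l))
  rw [integral_finsetSum _ fun k _ =>
    (continuous_finsetSum s fun l _ => hc k l).integrable_haarUnitary]
  refine sum_congr rfl fun k hk => ?_
  rw [integral_finsetSum _ fun l _ => (hc k l).integrable_haarUnitary, sum_eq_single_of_mem k hk]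
  · simp only [mul_pow]
  · intro l _ hlk
    -- For `l ≠ k`, multiplying row `i` by this phase negates the integrand, so its integral
    -- vanishes.
    obtain ⟨u, hu⟩ := exists_circle_pow_mul_conj_pow_eq_neg_one hlk.symm
    refine integral_eq_zero_of_mul_left_eq_neg (g := unitaryPhase i u) fun V => ?_
    rw [hGu, unitaryPhase_mul_apply, if_pos rfl, map_mul, mul_pow, mul_pow]
    linear_combination (G k l V * ((V : Matrix (Fin N) (Fin N) ℂ) i j ^ k *
        conj ((V : Matrix (Fin N) (Fin N) ℂ) i j) ^ l)) * hu

section FirstColumn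

variable {N : ℕ}

/-- Moments of the squared modulus of the upper left entry of a Haar unitary matrix. -/
noncomputable def entryMoment (N m : ℕ) : ℂ :=
  ∫ V : Matrix.unitaryGroup (Fin (N + 1)) ℂ, ((V : Matrix (Fin (N + 1)) (Fin (N + 1)) ℂ) 0 0 *
    conj ((V : Matrix (Fin (N + 1)) (Fin (N + 1)) ℂ) 0 0)) ^ m ∂haarUnitary (N + 1)

/-- If `M` is unitary with first column `w`, the sum is the corner entry of `star M * V`, and Haar
measure is left invariant. -/
theorem integral_dotProduct_col_pow (w : Fin (N + 1) → ℂ) (hw : ∑ i, ‖w i‖ ^ 2 = 1)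
    (hw1 : w 0 ≠ 1) (m : ℕ) :
    ∫ V : Matrix.unitaryGroup (Fin (N + 1)) ℂ,
      ((∑ i, conj (w i) * (V : Matrix (Fin (N + 1)) (Fin (N + 1)) ℂ) i 0) *
        conj (∑ i, conj (w i) * (V : Matrix (Fin (N + 1)) (Fin (N + 1)) ℂ) i 0)) ^ m
        ∂haarUnitary (N + 1) = entryMoment N m := by
  obtain ⟨M, -, -, -, -, -, hM⟩ := exists_complexReflection w hw hw1
  have h := haarUnitary_integral_mul_left (fun V : Matrix.unitaryGroup (Fin (N + 1)) ℂ =>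
    ((V : Matrix (Fin (N + 1)) (Fin (N + 1)) ℂ) 0 0 *
      conj ((V : Matrix (Fin (N + 1)) (Fin (N + 1)) ℂ) 0 0)) ^ m) (star M)
  rw [entryMoment, ← h]
  simp only [Submonoid.coe_mul, Unitary.coe_star, Matrix.mul_apply, Matrix.star_apply, hM,
    RCLike.star_def]

/-- The case `w = (e_0 + x e_j) / √(1 + x²)`, rescaled; `x ≠ 0` guarantees `w 0 ≠ 1`. -/
theorem integral_add_mul_col_pow {j : Fin (N + 1)} (hj : j ≠ 0) {x : ℝ} (hx : x ≠ 0) (m : ℕ) :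
    ∫ V : Matrix.unitaryGroup (Fin (N + 1)) ℂ,
      (((V : Matrix (Fin (N + 1)) (Fin (N + 1)) ℂ) 0 0 +
          x * (V : Matrix (Fin (N + 1)) (Fin (N + 1)) ℂ) j 0) *
        conj ((V : Matrix (Fin (N + 1)) (Fin (N + 1)) ℂ) 0 0 +
          x * (V : Matrix (Fin (N + 1)) (Fin (N + 1)) ℂ) j 0)) ^ m
        ∂haarUnitary (N + 1) = (1 + (x : ℂ) ^ 2) ^ m * entryMoment N m := by
  set r : ℝ := √(1 + x ^ 2) with hr
  have hr2 : r ^ 2 = 1 + x ^ 2 := Real.sq_sqrt (by positivity)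
  have hr0 : r ≠ 0 := by positivity
  have hr2' : (r : ℂ) ^ 2 = 1 + (x : ℂ) ^ 2 := by exact_mod_cast hr2
  have hr0' : (r : ℂ) ≠ 0 := by exact_mod_cast hr0
  let w : Fin (N + 1) → ℂ := fun i => ((if i = 0 then 1 else if i = j then x else 0 : ℝ) / r : ℝ)
  have hsum : ∀ f : Fin (N + 1) → ℂ, ∑ i, conj (w i) * f i = (f 0 + x * f j) / r := by
    intro f
    rw [← sum_subset (subset_univ {0, j}), sum_pair hj.symm]
    · simp [w, hj]
      field_simp
    · intro i _ hi
      simp only [mem_insert, mem_singleton, not_or] at hi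
      simp [w, hi.1, hi.2]
  have hw : ∑ i, ‖w i‖ ^ 2 = 1 := by
    have h := hsum w
    simp only [Complex.conj_mul'] at h
    have h2 : (w 0 + x * w j) / r = 1 := by
      simp only [w, if_neg hj]
      push_cast
      field_simp
      rw [hr2']
    rw [h2] at h
    exact_mod_cast h
  have hw1 : w 0 ≠ 1 := by
    simp only [w]
    intro h
    have h' : (1 : ℝ) / r = 1 := by exact_mod_cast h
    have h1 : r = 1 := by field_simp at h'; exact h'.symm
    rw [h1] at hr2
    have : x ^ 2 = 0 := by linarith
    exact hx (by simpa using this)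
  rw [← integral_dotProduct_col_pow w hw hw1 m, ← integral_const_mul]
  congr 1 with V
  rw [hsum, ← hr2', ← mul_pow]
  congr 1
  simp only [map_div₀, Complex.conj_ofReal]
  field_simp

/-- Expanding `integral_add_mul_col_pow` at exponent `m + 1`, with cross terms killed by phase
orthogonality, gives a polynomial identity in `x²`; the linear coefficient is the claim multiplied
by `m + 1`. -/
theorem integral_entry_pow_mul_entry (m : ℕ) {j : Fin (N + 1)} (hj : j ≠ 0) :
    (m + 1) * ∫ V : Matrix.unitaryGroup (Fin (N + 1)) ℂ,
      ((V : Matrix (Fin (N + 1)) (Fin (N + 1)) ℂ) 0 0 *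
        conj ((V : Matrix (Fin (N + 1)) (Fin (N + 1)) ℂ) 0 0)) ^ m *
      ((V : Matrix (Fin (N + 1)) (Fin (N + 1)) ℂ) j 0 *
        conj ((V : Matrix (Fin (N + 1)) (Fin (N + 1)) ℂ) j 0)) ∂haarUnitary (N + 1) =
      entryMoment N (m + 1) := by
  set A : ℕ → ℂ := fun k => ∫ V : Matrix.unitaryGroup (Fin (N + 1)) ℂ,
      ((V : Matrix (Fin (N + 1)) (Fin (N + 1)) ℂ) 0 0 *
        conj ((V : Matrix (Fin (N + 1)) (Fin (N + 1)) ℂ) 0 0)) ^ (m + 1 - k) *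
      ((V : Matrix (Fin (N + 1)) (Fin (N + 1)) ℂ) j 0 *
        conj ((V : Matrix (Fin (N + 1)) (Fin (N + 1)) ℂ) j 0)) ^ k ∂haarUnitary (N + 1) with hA
  have expand : ∀ x : ℝ, x ≠ 0 →
      ∑ k ∈ range (m + 2), ((m + 1).choose k : ℂ) ^ 2 * A k * ((x : ℂ) ^ 2) ^ k =
        (1 + (x : ℂ) ^ 2) ^ (m + 1) * entryMoment N (m + 1) := by
    intro x hx
    rw [← integral_add_mul_col_pow hj hx]
    have h := integral_sum_unitary_apply_pow_mul_conj j 0 (range (m + 2))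
      (fun k l V => ((m + 1).choose k : ℂ) * (m + 1).choose l * x ^ k * x ^ l *
        ((V : Matrix (Fin (N + 1)) (Fin (N + 1)) ℂ) 0 0 ^ (m + 1 - k) *
          conj ((V : Matrix (Fin (N + 1)) (Fin (N + 1)) ℂ) 0 0) ^ (m + 1 - l))) ?_ ?_
    · trans
      swap
      · refine h.symm.trans ?_
        congr 1 with V
        rw [mul_pow, ← map_pow, add_comm (_ : ℂ) (x * _ : ℂ), add_pow, map_sum, sum_mul_sum]
        refine sum_congr rfl fun k _ => sum_congr rfl fun l _ => ?_
        simp only [map_mul, map_pow, Complex.conj_ofReal, map_natCast]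
        ring
      · refine sum_congr rfl fun k _ => ?_
        rw [hA]
        simp only
        rw [mul_right_comm, ← integral_const_mul]
        congr 1 with V
        ring
    · intro k l
      have := continuous_unitary_apply (0 : Fin (N + 1)) 0
      have h2 := Complex.continuous_conj.comp this
      exact continuous_const.mul ((this.pow _).mul (h2.pow _))
    · intro k l u V
      simp [unitaryPhase_mul_apply, hj.symm]
  have hpoly : (∑ k ∈ range (m + 2), Polynomial.C (((m + 1).choose k : ℂ) ^ 2 * A k) *
      Polynomial.X ^ k) =
      Polynomial.C (entryMoment N (m + 1)) * (1 + Polynomial.X) ^ (m + 1) := by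
    refine Polynomial.eq_of_infinite_eval_eq _ _
      (Set.infinite_of_injective_forall_mem (f := fun n : ℕ => (((n + 1 : ℝ) : ℂ)) ^ 2) ?_ ?_)
    · intro a b hab
      have h : ((a + 1) ^ 2 : ℕ) = (b + 1) ^ 2 := by
        simp only at hab
        exact_mod_cast hab
      have := Nat.pow_left_injective (n := 2) (by norm_num) h
      omega
    · intro n
      have := expand (n + 1) (by positivity)
      simp only [Set.mem_ofPred_eq, Polynomial.eval_finsetSum, Polynomial.eval_mul,
        Polynomial.eval_C, Polynomial.eval_pow, Polynomial.eval_X, Polynomial.eval_add,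
        Polynomial.eval_one]
      rw [this, mul_comm]
  have hcoeff := congrArg (fun q => Polynomial.coeff q 1) hpoly
  simp only [Polynomial.finsetSum_coeff, Polynomial.coeff_C_mul, Polynomial.coeff_X_pow,
    Polynomial.coeff_one_add_X_pow] at hcoeff
  rw [sum_eq_single_of_mem 1 (by simp) (fun k _ hk => by simp [hk.symm])] at hcoeff
  simp only [Nat.choose_one_right, if_true, mul_one, hA, pow_one, Nat.add_sub_cancel] at hcoeff
  have hm : ((m + 1 : ℕ) : ℂ) ≠ 0 := by exact_mod_cast m.succ_ne_zero
  refine mul_left_cancel₀ hm ?_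
  rw [← Nat.cast_succ]
  linear_combination hcoeff

/-- Sum `integral_entry_pow_mul_entry` over `j ≠ 0` and use that the first column has norm `1`. -/
theorem entryMoment_succ (N m : ℕ) :
    (N + m + 1) * entryMoment N (m + 1) = (m + 1) * entryMoment N m := by
  have hV : ∀ V : Matrix.unitaryGroup (Fin (N + 1)) ℂ,
      ∑ j : Fin N, ((V : Matrix (Fin (N + 1)) (Fin (N + 1)) ℂ) 0 0 *
        conj ((V : Matrix (Fin (N + 1)) (Fin (N + 1)) ℂ) 0 0)) ^ m *
      ((V : Matrix (Fin (N + 1)) (Fin (N + 1)) ℂ) j.succ 0 *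
        conj ((V : Matrix (Fin (N + 1)) (Fin (N + 1)) ℂ) j.succ 0)) =
      ((V : Matrix (Fin (N + 1)) (Fin (N + 1)) ℂ) 0 0 *
        conj ((V : Matrix (Fin (N + 1)) (Fin (N + 1)) ℂ) 0 0)) ^ m -
      ((V : Matrix (Fin (N + 1)) (Fin (N + 1)) ℂ) 0 0 *
        conj ((V : Matrix (Fin (N + 1)) (Fin (N + 1)) ℂ) 0 0)) ^ (m + 1) := by
    intro V
    have h := unitary_sum_col V.2 0
    rw [Fin.sum_univ_succ] at h
    have h' : ∑ j : Fin N, ((V : Matrix (Fin (N + 1)) (Fin (N + 1)) ℂ) j.succ 0 *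
        conj ((V : Matrix (Fin (N + 1)) (Fin (N + 1)) ℂ) j.succ 0)) =
        1 - (V : Matrix (Fin (N + 1)) (Fin (N + 1)) ℂ) 0 0 *
        conj ((V : Matrix (Fin (N + 1)) (Fin (N + 1)) ℂ) 0 0) := by
      simp only [Complex.mul_conj']
      rw [eq_sub_iff_add_eq, add_comm]
      exact_mod_cast h
    rw [← mul_sum, h']
    ring
  have hc : ∀ i : Fin (N + 1), Continuous fun V : Matrix.unitaryGroup (Fin (N + 1)) ℂ =>
      (V : Matrix (Fin (N + 1)) (Fin (N + 1)) ℂ) i 0 *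
        conj ((V : Matrix (Fin (N + 1)) (Fin (N + 1)) ℂ) i 0) := fun i =>
    (continuous_unitary_apply i 0).mul
      (Complex.continuous_conj.comp (continuous_unitary_apply i 0))
  have h1 := integral_congr_ae (μ := haarUnitary (N + 1)) (ae_of_all _ hV)
  rw [integral_finsetSum _ fun j _ => (((hc 0).pow m).mul (hc j.succ)).integrable_haarUnitary,
    integral_sub (Continuous.integrable_haarUnitary (by exact (hc 0).pow m))
      (Continuous.integrable_haarUnitary (by exact (hc 0).pow (m + 1)))] at h1
  have h2 := congrArg (fun z => (m + 1 : ℂ) * z) h1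
  simp only [mul_sum] at h2
  rw [sum_congr rfl fun j _ => integral_entry_pow_mul_entry m (Fin.succ_ne_zero j)] at h2
  simp only [sum_const, card_univ, Fintype.card_fin, nsmul_eq_mul] at h2
  rw [← entryMoment, ← entryMoment] at h2
  linear_combination h2

theorem entryMoment_eq (N m : ℕ) : entryMoment N m = ((N + m).choose m : ℂ)⁻¹ := by
  induction m with
  | zero => simp [entryMoment]
  | succ m ih =>
    have h := entryMoment_succ N m
    rw [ih] at h
    have hc : ((N + m).choose m : ℂ) ≠ 0 := by
      exact_mod_cast (Nat.choose_pos (Nat.le_add_left m N)).ne'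
    have hd : ((N + (m + 1)).choose (m + 1) : ℂ) ≠ 0 := by
      exact_mod_cast (Nat.choose_pos (Nat.le_add_left (m + 1) N)).ne'
    have hs : ((N + m + 1 : ℕ) : ℂ) * (N + m).choose m =
        (N + (m + 1)).choose (m + 1) * (m + 1 : ℕ) := by
      exact_mod_cast Nat.add_one_mul_choose_eq (N + m) m
    have hN : (N + m + 1 : ℂ) ≠ 0 := by exact_mod_cast (N + m).succ_ne_zero
    push_cast at hs
    field_simp at h
    rw [← mul_eq_one_iff_eq_inv₀ hd]
    refine mul_left_cancel₀ (mul_ne_zero hN hc) ?_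
    linear_combination ((N + (m + 1)).choose (m + 1) : ℂ) * h - hs

/-- Of the double binomial expansion only the diagonal terms survive phase averaging. -/
theorem integral_norm_one_sub_entry_pow (N p : ℕ) :
    ∫ V : Matrix.unitaryGroup (Fin (N + 1)) ℂ,
      ‖1 - (V : Matrix (Fin (N + 1)) (Fin (N + 1)) ℂ) 0 0‖ ^ (2 * p) ∂haarUnitary (N + 1) =
      ∑ k ∈ range (p + 1), (p.choose k : ℝ) ^ 2 / (N + k).choose k := by
  have h := integral_sum_unitary_apply_pow_mul_conj (0 : Fin (N + 1)) 0 (range (p + 1))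
      (fun k l _ => (-1) ^ k * (-1) ^ l * ((p.choose k : ℂ) * p.choose l))
      (fun k l => continuous_const) (fun k l u V => rfl)
  apply Complex.ofReal_injective
  rw [← integral_complex_ofReal]
  trans
  swap
  · refine h.trans ?_
    push_cast
    refine sum_congr rfl fun k _ => ?_
    rw [integral_const_mul, ← entryMoment, entryMoment_eq, ← mul_pow]
    simp
    ring
  · congr 1 with V
    push_cast
    rw [pow_mul, ← Complex.mul_conj', mul_pow, ← map_pow, sub_eq_neg_add, add_pow, map_sum,
      sum_mul_sum]
    refine sum_congr rfl fun k _ => sum_congr rfl fun l _ => ?_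
    simp only [one_pow, mul_one, map_mul, map_pow, map_natCast, map_neg]
    rw [neg_pow, neg_pow (conj _)]
    ring

end FirstColumn

/-! ### Closed form of the moments of `|det (1 - V)|`. -/

theorem risingFactorial_natCast_add_one (n p : ℕ) :
    risingFactorial (n + 1) p * n.factorial = (n + p).factorial := by
  induction p with
  | zero => simp [risingFactorial]
  | succ p ih =>
    rw [risingFactorial_succ, ← add_assoc, Nat.factorial_succ]
    push_cast
    rw [← ih]
    ring

/-- After factoring out a quantity independent of `k`, this is Vandermonde's identity for `(p + (N +
p)).choose p`. -/
theorem sum_choose_sq_div_choose (N p : ℕ) :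
    ∑ k ∈ range (p + 1), (p.choose k : ℝ) ^ 2 / (N + k).choose k =
      risingFactorial (N + 1) (2 * p) / risingFactorial (N + 1) p ^ 2 := by
  have hvan : ∑ k ∈ range (p + 1), (p.choose k : ℝ) * (N + p).choose (p - k) =
      (p + (N + p)).choose p := by
    rw [Nat.add_choose_eq, Nat.sum_antidiagonal_eq_sum_range_succ_mk]
    push_cast
    rfl
  have hf : ∀ n : ℕ, (n.factorial : ℝ) ≠ 0 := fun n => by exact_mod_cast n.factorial_ne_zero
  have hterm : ∀ k ∈ range (p + 1), (p.choose k : ℝ) ^ 2 / (N + k).choose k =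
      (p.factorial * N.factorial / (N + p).factorial) *
        ((p.choose k : ℝ) * (N + p).choose (p - k)) := by
    intro k hk
    have hkp : k ≤ p := Nat.lt_succ_iff.1 (mem_range.1 hk)
    rw [Nat.cast_choose ℝ hkp, Nat.cast_choose ℝ (Nat.le_add_left k N),
      Nat.cast_choose ℝ (show p - k ≤ N + p by omega), Nat.add_sub_cancel,
      show N + p - (p - k) = N + k by omega]
    have := hf k
    have := hf (p - k)
    have := hf (N + k)
    have := hf (N + p)
    have := hf N
    have := hf p
    field_simp
  rw [sum_congr rfl hterm, ← mul_sum, hvan, Nat.cast_choose ℝ (Nat.le_add_right p (N + p)),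
    Nat.add_sub_cancel_left, show p + (N + p) = N + 2 * p by ring,
    ← risingFactorial_natCast_add_one, ← risingFactorial_natCast_add_one]
  have := hf p
  have := hf N
  have := (risingFactorial_pos (a := N + 1) (by positivity) p).ne'
  field_simp

theorem integral_norm_det_one_sub_pow (N p : ℕ) :
    ∫ V, ‖(1 - (V : Matrix (Fin N) (Fin N) ℂ)).det‖ ^ (2 * p) ∂haarUnitary N =
      ∏ j ∈ range N, risingFactorial (j + 1) (2 * p) / risingFactorial (j + 1) p ^ 2 := by
  induction N with
  | zero => simp
  | succ N ih =>
    rw [integral_norm_det_pow_succ, ih, prod_range_succ, integral_norm_one_sub_entry_pow,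
      sum_choose_sq_div_choose, mul_comm]

/-! ### Rotation of the spectrum and almost sure non-vanishing. -/

/-- The scalar unitary matrix `u`. -/
def unitaryScalar (N : ℕ) (u : Circle) : Matrix.unitaryGroup (Fin N) ℂ :=
  ⟨(u : ℂ) • 1, by
    rw [Matrix.mem_unitaryGroup_iff, star_smul, star_one, smul_mul_smul_comm, one_mul,
      RCLike.star_def, Complex.mul_conj', Circle.norm_coe]
    simp⟩

theorem coe_unitaryScalar_mul {N : ℕ} (u : Circle) (V : Matrix.unitaryGroup (Fin N) ℂ) :
    ((unitaryScalar N u * V : Matrix.unitaryGroup (Fin N) ℂ) : Matrix (Fin N) (Fin N) ℂ) =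
      (u : ℂ) • (V : Matrix (Fin N) (Fin N) ℂ) := by
  simp [unitaryScalar]

theorem continuous_det_one_sub_unitary (N : ℕ) :
    Continuous fun V : Matrix.unitaryGroup (Fin N) ℂ =>
      (1 - (V : Matrix (Fin N) (Fin N) ℂ)).det :=
  (continuous_const.sub continuous_subtype_val).matrix_det

theorem charPolyZ_eq_det_one_sub {N : ℕ} (V : Matrix.unitaryGroup (Fin N) ℂ) (θ : ℝ) :
    charPolyZ V θ = (1 - ((unitaryScalar N (Circle.exp (-θ)) * V :
      Matrix.unitaryGroup (Fin N) ℂ) : Matrix (Fin N) (Fin N) ℂ)).det := by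
  rw [coe_unitaryScalar_mul, charPolyZ, Circle.coe_exp]
  congr 4
  push_cast
  ring

/-- Such `z` are eigenvalues of `star V`. -/
theorem finite_setOfPred_det_one_sub_smul_eq_zero {N : ℕ} (V : Matrix.unitaryGroup (Fin N) ℂ) :
    {z : ℂ | (1 - z • (V : Matrix (Fin N) (Fin N) ℂ)).det = 0}.Finite := by
  refine (Polynomial.finite_setOfPred_isRoot
    (Matrix.charpoly_monic (star (V : Matrix (Fin N) (Fin N) ℂ))).ne_zero).subset fun z hz => ?_
  have h : Matrix.scalar (Fin N) z - star (V : Matrix (Fin N) (Fin N) ℂ) =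
      -((1 - z • (V : Matrix (Fin N) (Fin N) ℂ)) * star (V : Matrix (Fin N) (Fin N) ℂ)) := by
    rw [sub_mul, one_mul, smul_mul_assoc, Matrix.mem_unitaryGroup_iff.1 V.2, Matrix.scalar_apply,
      ← Matrix.smul_one_eq_diagonal, neg_sub]
  change Polynomial.eval z _ = 0
  rw [Matrix.eval_charpoly, h, Matrix.det_neg, Matrix.det_mul, hz, zero_mul, mul_zero]

/-- For fixed `V`, only finitely many `t ∈ (0, 1]` make `det (1 - e^{it} V)` vanish. By Fubini the
average over `t` of the measures of the rotated null sets is `0`, yet by invariance they all equal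
that of `S`. -/
theorem ae_det_one_sub_ne_zero (N : ℕ) :
    ∀ᵐ V : Matrix.unitaryGroup (Fin N) ℂ ∂haarUnitary N, (1 - (V : Matrix (Fin N) (Fin N) ℂ)).det ≠ 0 := by
  set S : Set (Matrix.unitaryGroup (Fin N) ℂ) :=
    {V | (1 - (V : Matrix (Fin N) (Fin N) ℂ)).det = 0} with hS
  have hSc : IsClosed S := isClosed_eq (continuous_det_one_sub_unitary N) continuous_const
  set ν : Measure ℝ := volume.restrict (Set.Ioc 0 1) with hν
  have hscalar : Continuous fun t : ℝ => unitaryScalar N (Circle.exp t) := by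
    refine Continuous.subtype_mk ?_ _
    exact (continuous_subtype_val.comp Circle.exp.continuous).smul continuous_const
  set T : Set (Matrix.unitaryGroup (Fin N) ℂ × ℝ) :=
    {z | unitaryScalar N (Circle.exp z.2) * z.1 ∈ S} with hT
  have hTc : IsClosed T := hSc.preimage ((hscalar.comp continuous_snd).mul continuous_fst)
  have hslice : ∀ V, ν (Prod.mk V ⁻¹' T) = 0 := by
    intro V
    rw [hν, Measure.restrict_apply' measurableSet_Ioc]
    refine Set.Finite.measure_zero (((finite_setOfPred_det_one_sub_smul_eq_zero V).image
      Complex.arg).subset ?_) _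
    rintro t ⟨ht, ht0, ht1⟩
    refine ⟨Circle.exp t, ?_, Circle.arg_exp ?_ ?_⟩
    · rw [Set.mem_ofPred_eq, ← coe_unitaryScalar_mul]
      exact ht
    · linarith [Real.pi_pos]
    · linarith [Real.pi_gt_three]
  have h1 : ((haarUnitary N).prod ν) T = 0 := by
    rw [Measure.prod_apply hTc.measurableSet]
    simp [hslice]
  rw [Measure.prod_apply_symm hTc.measurableSet] at h1
  have h2 : ∀ t : ℝ, haarUnitary N ((fun V => (V, t)) ⁻¹' T) = haarUnitary N S := fun t =>
    measure_preimage_mul (haarUnitary N) (unitaryScalar N (Circle.exp t)) S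
  simp only [h2, lintegral_const, hν, Measure.restrict_apply_univ, Real.volume_Ioc, sub_zero,
    ENNReal.ofReal_one, mul_one] at h1
  exact measure_eq_zero_iff_ae_notMem.1 h1

/-! ### Infinite divisibility. -/

theorem IsHausdorffMomentSeq.const_pow {c : ℝ} (hc0 : 0 ≤ c) (hc1 : c ≤ 1) :
    IsHausdorffMomentSeq fun p => c ^ p :=
  ⟨⟨Measure.dirac ⟨c, hc0, hc1⟩, inferInstance⟩, fun p => by simp⟩

/-- Each of the `N` duplication factors needs a division by `4 ^ p`; a larger `C` only adds an
independent constant factor `(4 ^ N / C) ^ t`. -/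
theorem isHausdorffMomentSeq_haar_rpow (N : ℕ) {C t : ℝ} (hC : 4 ^ N ≤ C) (ht : 0 ≤ t) :
    IsHausdorffMomentSeq fun p => ((∫ V,
      ‖(1 - (V : Matrix (Fin N) (Fin N) ℂ)).det‖ ^ (2 * p) ∂haarUnitary N) / C ^ p) ^ t := by
  have hC0 : 0 < C := lt_of_lt_of_le (by positivity) hC
  have hc0 : 0 ≤ (4 : ℝ) ^ N / C := by positivity
  have hc1 : (4 : ℝ) ^ N / C ≤ 1 := div_le_one_of_le₀ hC hC0.le
  have h1 := IsHausdorffMomentSeq.prod (range N) fun j _ =>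
    IsHausdorffMomentSeq.duplication_rpow (a := (j : ℝ) + 1) (by simp) ht
  have h2 := IsHausdorffMomentSeq.const_pow (Real.rpow_nonneg hc0 t) (Real.rpow_le_one hc0 hc1 ht)
  convert h1.mul h2 using 2 with p
  have hpos : ∀ j : ℕ, 0 ≤ risingFactorial ((j : ℝ) + 1) (2 * p) /
      risingFactorial ((j : ℝ) + 1) p ^ 2 / 4 ^ p := fun j => by
    have := risingFactorial_pos (a := (j : ℝ) + 1) (by positivity) (2 * p)
    positivity
  have hcomm : (((4 : ℝ) ^ N / C) ^ t) ^ p = (((4 : ℝ) ^ N / C) ^ p) ^ t := by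
    rw [← Real.rpow_mul_natCast hc0, ← Real.rpow_natCast_mul hc0, mul_comm]
  rw [integral_norm_det_one_sub_pow, Real.finsetProd_rpow _ _ fun j _ => hpos j, hcomm,
    ← Real.mul_rpow (prod_nonneg fun j _ => hpos j) (by positivity), prod_div_distrib (g := fun _ => (4 : ℝ) ^ p),
    prod_const, card_range]
  congr 1
  rw [div_pow, ← pow_mul, ← pow_mul, mul_comm p N]
  field_simp

/-- The law of `log |det (1 - V)|` for a Haar unitary matrix `V` is infinitely divisible. -/
theorem isInfinitelyDivisible_log_det_one_sub (N : ℕ) :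
    IsInfinitelyDivisible ((haarUnitary N).map fun V : Matrix.unitaryGroup (Fin N) ℂ =>
      Real.log ‖(1 - (V : Matrix (Fin N) (Fin N) ℂ)).det‖) := by
  obtain ⟨B, hB⟩ := (isCompact_range (continuous_det_one_sub_unitary N).norm).bddAbove
  -- `4 ^ N ≤ C` serves the moment lemma, `B ^ 2 ≤ C` places `|det|² / C` in `[0, 1]`.
  obtain ⟨C, hC4, hCB⟩ : ∃ C : ℝ, 4 ^ N ≤ C ∧ B ^ 2 ≤ C := ⟨_, le_max_left _ _, le_max_right _ _⟩
  have hC : 0 < C := lt_of_lt_of_le (by positivity) hC4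
  have hle : ∀ V : Matrix.unitaryGroup (Fin N) ℂ,
      ‖(1 - (V : Matrix (Fin N) (Fin N) ℂ)).det‖ ^ 2 / C ∈ Set.Icc (0 : ℝ) 1 := fun V =>
    ⟨by positivity, div_le_one_of_le₀
      ((pow_le_pow_left₀ (norm_nonneg _) (hB ⟨V, rfl⟩) 2).trans hCB) hC.le⟩
  let X : Matrix.unitaryGroup (Fin N) ℂ → unitInterval := fun V => ⟨_, hle V⟩
  have hX : Measurable X := (Continuous.subtype_mk
    (((continuous_det_one_sub_unitary N).norm.pow 2).div_const C) _).measurable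
  have : IsProbabilityMeasure ((haarUnitary N).map X) :=
    Measure.isProbabilityMeasure_map hX.aemeasurable
  intro n hn
  have hn0 : (n : ℝ) ≠ 0 := by positivity
  obtain ⟨⟨ρ, hρ⟩, hmom⟩ := isHausdorffMomentSeq_haar_rpow N hC4 (t := 1 / n) (by positivity)
  simp only [ProbabilityMeasure.coe_mk] at hmom
  have hπ : Measurable fun x : Fin n → unitInterval => ∏ i, x i :=
    (continuous_finsetProd _ fun i _ => continuous_apply i).measurable
  have : IsProbabilityMeasure ((Measure.pi fun _ : Fin n => ρ).map fun x => ∏ i, x i) :=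
    Measure.isProbabilityMeasure_map hπ.aemeasurable
  have hcoe : ∀ x : Fin n → unitInterval, ((∏ i, x i : unitInterval) : ℝ) = ∏ i, (x i : ℝ) :=
    fun x => map_prod (⟨⟨Subtype.val, rfl⟩, fun _ _ => rfl⟩ : unitInterval →* ℝ) x univ
  have hlaw : (Measure.pi fun _ : Fin n => ρ).map (fun x => ∏ i, x i) =
      (haarUnitary N).map X := by
    refine unitInterval_measure_ext_of_moments fun p => ?_
    rw [integral_map hπ.aemeasurable (by fun_prop), integral_map hX.aemeasurable (by fun_prop)]
    simp only [hcoe, ← prod_pow]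
    rw [integral_fintype_prod_eq_prod (fun (_ : Fin n) (x : unitInterval) => (x : ℝ) ^ p)]
    simp only [hmom, prod_const, card_univ, Fintype.card_fin]
    rw [← Real.rpow_mul_natCast (div_nonneg (integral_nonneg fun V => by positivity)
      (by positivity)), one_div_mul_cancel hn0, Real.rpow_one, ← integral_div]
    congr 1 with V
    simp only [X, div_pow, pow_mul]
  -- `h` recovers `log |det|` from `|det|² / C`; `g` carries an equal share of the constant `log C /
  -- 2` in each of the `n` summands.
  let g : unitInterval → ℝ := fun x => Real.log x / 2 + Real.log C / (2 * n)
  let h : unitInterval → ℝ := fun y => Real.log y / 2 + Real.log C / 2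
  have hg : Measurable g := by fun_prop
  have hh : Measurable h := by fun_prop
  -- Since `Real.log 0 = 0`, the logarithm of a product splits only off zero; a nonzero product
  -- forces nonzero factors.
  have hne : ∀ᵐ y ∂(haarUnitary N).map X, y ≠ 0 := by
    refine (ae_map_iff hX.aemeasurable (measurableSet_singleton 0).compl).2 ?_
    filter_upwards [ae_det_one_sub_ne_zero N] with V hV h0
    have : ‖(1 - (V : Matrix (Fin N) (Fin N) ℂ)).det‖ ^ 2 / C = 0 := congrArg Subtype.val h0
    have h2 : 0 < ‖(1 - (V : Matrix (Fin N) (Fin N) ℂ)).det‖ := norm_pos_iff.2 hV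
    have : 0 < ‖(1 - (V : Matrix (Fin N) (Fin N) ℂ)).det‖ ^ 2 / C := by positivity
    linarith
  have hgP : IsProbabilityMeasure (ρ.map g) := Measure.isProbabilityMeasure_map hg.aemeasurable
  refine ⟨ρ.map g, hgP, ?_⟩
  calc (haarUnitary N).map (fun V : Matrix.unitaryGroup (Fin N) ℂ =>
        Real.log ‖(1 - (V : Matrix (Fin N) (Fin N) ℂ)).det‖)
      = (haarUnitary N).map (h ∘ X) := by
        refine Measure.map_congr ?_
        filter_upwards [ae_det_one_sub_ne_zero N] with V hV
        have h2 : ‖(1 - (V : Matrix (Fin N) (Fin N) ℂ)).det‖ ≠ 0 := norm_ne_zero_iff.2 hV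
        simp only [h, X, Function.comp_apply]
        rw [Real.log_div (pow_ne_zero 2 h2) hC.ne', Real.log_pow]
        push_cast
        ring
    _ = (Measure.pi fun _ : Fin n => ρ).map (h ∘ fun x => ∏ i, x i) := by
        rw [← Measure.map_map hh hX, ← hlaw, Measure.map_map hh hπ]
    _ = (Measure.pi fun _ : Fin n => ρ).map ((fun x => ∑ i, x i) ∘ fun x i => g (x i)) := by
        refine Measure.map_congr ?_
        rw [← hlaw] at hne
        filter_upwards [ae_of_ae_map hπ.aemeasurable hne] with x hx
        have hx' : ∀ i ∈ univ, (x i : ℝ) ≠ 0 := by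
          refine prod_ne_zero_iff.1 ?_
          rw [← hcoe]
          exact fun h0 => hx (Subtype.ext h0)
        simp only [h, g, Function.comp_apply, hcoe]
        rw [Real.log_prod hx', sum_add_distrib, sum_div, sum_const, card_univ, Fintype.card_fin,
          nsmul_eq_mul]
        field_simp
    _ = (Measure.pi fun _ : Fin n => ρ.map g).map (fun x => ∑ i, x i) := by
        rw [← Measure.map_map (by fun_prop) (by fun_prop), Measure.pi_map_pi fun _ => hg.aemeasurable]

/-- By left invariance `e^{-iθ} V` is again Haar distributed, which reduces to `θ = 0`. -/
theorem proposition3p5 (N : ℕ) (hN : 1 ≤ N) (θ : ℝ)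
    {Ω : Type*} [MeasurableSpace Ω] (P : Measure Ω)
    (V : Ω → Matrix.unitaryGroup (Fin N) ℂ)
    (hV : ProbabilityTheory.HasLaw V (haarUnitary N) P) :
    (∀ᵐ ω ∂P, charPolyZ (V ω) θ ≠ 0) ∧
      IsInfinitelyDivisible (P.map fun ω => Real.log ‖charPolyZ (V ω) θ‖) := by
  have hmeas : Measurable fun U : Matrix.unitaryGroup (Fin N) ℂ =>
      Real.log ‖(1 - (U : Matrix (Fin N) (Fin N) ℂ)).det‖ :=
    Real.measurable_log.comp (continuous_det_one_sub_unitary N).norm.measurable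
  have hmul : Measurable fun U : Matrix.unitaryGroup (Fin N) ℂ =>
      unitaryScalar N (Circle.exp (-θ)) * U := (continuous_const_mul _).measurable
  have hinv := map_mul_left_eq_self (haarUnitary N) (unitaryScalar N (Circle.exp (-θ)))
  simp only [charPolyZ_eq_det_one_sub]
  constructor
  · refine ae_of_ae_map hV.aemeasurable (p := fun U => (1 - ((unitaryScalar N (Circle.exp (-θ)) * U :
      Matrix.unitaryGroup (Fin N) ℂ) : Matrix (Fin N) (Fin N) ℂ)).det ≠ 0) ?_
    rw [hV.map_eq]
    refine ae_of_ae_map hmul.aemeasurable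
      (p := fun U : Matrix.unitaryGroup (Fin N) ℂ => (1 - (U : Matrix (Fin N) (Fin N) ℂ)).det ≠ 0) ?_
    rw [hinv]
    exact ae_det_one_sub_ne_zero N
  · have h := isInfinitelyDivisible_log_det_one_sub N
    rw [← hinv, Measure.map_map hmeas hmul, ← hV.map_eq,
      AEMeasurable.map_map_of_aemeasurable (hmeas.comp hmul).aemeasurable hV.aemeasurable] at h
    exact h
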